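/- Theorem (Time dependent Hartree method). Let $V_1,\dots,V_d$ be real pre-Hilbert spaces with scalar products $\langle\cdot,\cdot\rangle_j$, and let $\mathbf V_{\|\cdot\|}$ be the completion of the algebraic tensor product $\mathbf V=\bigotimes_{j=1}^d V_j$ with respect to the induced scalar product, $\langle\bigotimes_j x_j,\bigotimes_j y_j\rangle=\prod_j\langle x_j,y_j\rangle_j$. Let $\mathcal M\subset\mathbf V$ be the Hartree manifold of tensors of rank $(1,\dots,1)$, i.e. $\mathcal M=\{c\bigotimes_j a_j: c\ne 0,\ a_j\in V_j\setminus\{0\}\}$. For $\mathbf v\in\mathcal M$ let $\mathbf Z(\mathbf v)\subset\mathbf V_{\|\cdot\|}$ be the image of the tangent space of $\mathcal M$ at $\mathbf v$ under the tangent map of the inclusion $\mathcal M\subset\mathbf V_{\|\cdot\|}$; for $\mathbf v=c\bigotimes_j a_j$ it is the range of the derivative at $(0,c)$ of the local parametrisation $((w_j)_j,s)\mapsto s\bigotimes_j(a_j+w_j)$, $w_j\in\mathrm{span}\{a_j\}^\perp$, $s\in\mathbb R$. Let $\mathcal P_{\mathbf v}$ be the metric projection onto $\mathbf Z(\mathbf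 v)$. Let $A$ be a (possibly unbounded) linear operator in $\mathbf V_{\|\cdot\|}$ with domain $\mathcal D(A)$. Let $\varepsilon>0$, let $\lambda\in C^1([0,\varepsilon),\mathbb R)$ and $v_j\in C^1([0,\varepsilon),V_j)$ with $\|v_j(t)\|_j=1$ for all $t\in[0,\varepsilon)$ and $1\le j\le d$, and suppose that $\mathbf v_r(t)=\lambda(t)\bigotimes_{j=1}^d v_j(t)$ is a curve in $\mathcal M$ with $\mathbf v_r(t)\in\mathcal D(A)$ for $t\in(0,\varepsilon)$ that solves the Dirac–Frenkel reduced order model $$\dot{\mathbf v}_r(t)=\mathcal P_{\mathbf v_r(t)}(A\mathbf v_r(t))\ \text{ for } t\in(0,\varepsilon),\qquad \mathbf v_r(0)=\lambda_0\bigotimes_{j=1}^d v_0^{(j)},$$ where $\|v_0^{(j)}\|_j=1$ for all $j$ and $\lambda(0)=\lambda_0$. Then, for all $t\in(0,\varepsilon)$, $\bigotimes_j v_j(t)\in\mathcal D(A)$, and for all $1\le j\le d$ $$\langle\dot v_j(t),w_j\rangle_j-\mathrm a_j(t;v_j(t),w_j)=0\quad\text{for all } w_j\in\mathbb T_{v_j(t)}(\mathbb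 S_{V_j})=\{w\in V_j:\langle v_j(t),w\rangle_j=0\},$$ where $\mathrm a_k(t;z,y)=\big\langle A\big(z\otimes\bigotimes_{j\ne k}v_j(t)\big),\,y\otimes\bigotimes_{j\ne k}v_j(t)\big\rangle$ for $z,y\in V_k$ (whenever $z\otimes\bigotimes_{j\ne k}v_j(t)\in\mathcal D(A)$). Moreover, for all $t\in[0,\varepsilon)$, the function $s\mapsto\langle A\bigotimes_j v_j(s),\bigotimes_j v_j(s)\rangle$ is integrable on $(0,t)$ and $$\lambda(t)=\lambda_0\exp\left(\int_0^t\Big\langle A\bigotimes_{j=1}^d v_j(s),\bigotimes_{j=1}^d v_j(s)\Big\rangle\,ds\right).$$ -/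

import Mathlib

open scoped TensorProduct InnerProductSpace Topology

set_option linter.unusedSectionVars false

noncomputable section

namespace Hartree

universe u v

section Tensor

variable {ι : Type u} [Fintype ι] (V : ι → Type v)
  [∀ j, NormedAddCommGroup (V j)] [∀ j, InnerProductSpace ℝ (V j)]

/-- The algebraic tensor product of the pre-Hilbert spaces `V j`. It is a type synonym, because
Mathlib equips `⨂[ℝ] j, V j` with the projective seminorm, whereas here it carries the norm of the
induced scalar product. -/
def AlgTensor : Type (max u v) := ⨂[ℝ] j, V j

instance : AddCommGroup (AlgTensor V) := inferInstanceAs (AddCommGroup (⨂[ℝ] j, V j))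

instance : Module ℝ (AlgTensor V) := inferInstanceAs (Module ℝ (⨂[ℝ] j, V j))

/-- The elementary tensor `⨂ j, x j` in the algebraic tensor product, as a multilinear map. -/
def algTprod : MultilinearMap ℝ V (AlgTensor V) := PiTensorProduct.tprod ℝ

/-- The induced scalar product as a bilinear form: the unique bilinear form whose value at two
elementary tensors `⨂ x j`, `⨂ y j` is `∏ j, ⟪x j, y j⟫`. -/
def inducedForm : AlgTensor V →ₗ[ℝ] AlgTensor V →ₗ[ℝ] ℝ :=
  PiTensorProduct.dualDistrib ∘ₗ PiTensorProduct.map (fun j => innerₗ (V j))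

variable {V}

theorem inducedForm_tprod (x y : ∀ j, V j) :
    inducedForm V (algTprod V x) (algTprod V y) = ∏ j, ⟪x j, y j⟫_ℝ := by
  change PiTensorProduct.dualDistrib
    (PiTensorProduct.map (fun j => innerₗ (V j)) (PiTensorProduct.tprod ℝ x))
    (PiTensorProduct.tprod ℝ y) = _
  rw [PiTensorProduct.map_tprod, PiTensorProduct.dualDistrib_apply]
  rfl

theorem algTensor_induction {p : AlgTensor V → Prop} (x : AlgTensor V)
    (smul : ∀ (r : ℝ) (f : ∀ j, V j), p (r • algTprod V f))
    (add : ∀ x y, p x → p y → p (x + y)) : p x :=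
  PiTensorProduct.induction_on (motive := p) x smul add

theorem inducedForm_symm (x y : AlgTensor V) : inducedForm V x y = inducedForm V y x := by
  induction x using algTensor_induction with
  | smul r f =>
    induction y using algTensor_induction with
    | smul s g =>
      simp only [map_smul, LinearMap.smul_apply, inducedForm_tprod, real_inner_comm, smul_eq_mul]
      ring
    | add y z hy hz => rw [map_add, map_add, LinearMap.add_apply, hy, hz]
  | add x z hx hz => rw [map_add, map_add, LinearMap.add_apply, hx, hz]

/-- Inclusion of the tensor product of subspaces. -/
def inclTensor (F : ∀ j, Submodule ℝ (V j)) : AlgTensor (fun j => F j) →ₗ[ℝ] AlgTensor V :=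
  PiTensorProduct.mapIncl F

theorem inclTensor_tprod (F : ∀ j, Submodule ℝ (V j)) (x : ∀ j, F j) :
    inclTensor F (algTprod (fun j => F j) x) = algTprod V (fun j => (x j : V j)) :=
  PiTensorProduct.map_tprod _ _

theorem inducedForm_incl (F : ∀ j, Submodule ℝ (V j)) (x y : AlgTensor (fun j => F j)) :
    inducedForm V (inclTensor F x) (inclTensor F y) = inducedForm (fun j => F j) x y := by
  induction x using algTensor_induction with
  | smul r f =>
    induction y using algTensor_induction with
    | smul s g =>
      simp only [map_smul, LinearMap.smul_apply, inducedForm_tprod, inclTensor_tprod,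
        Submodule.coe_inner]
    | add y z hy hz => simp only [map_add, hy, hz]
  | add x z hx hz => simp only [map_add, LinearMap.add_apply, hx, hz]

theorem range_inclTensor_mono {F G : ∀ j, Submodule ℝ (V j)} (h : ∀ j, F j ≤ G j)
    (x : AlgTensor (fun j => F j)) : inclTensor F x ∈ LinearMap.range (inclTensor G) := by
  induction x using algTensor_induction with
  | smul r f =>
    rw [map_smul, inclTensor_tprod]
    refine Submodule.smul_mem _ _ ⟨algTprod (fun j => G j) (fun j => ⟨f j, h j (f j).2⟩), ?_⟩
    rw [inclTensor_tprod]
  | add x y hx hy => rw [map_add]; exact Submodule.add_mem _ hx hy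

theorem exists_finite_incl (x : AlgTensor V) : ∃ F : ∀ j, Submodule ℝ (V j),
    (∀ j, FiniteDimensional ℝ (F j)) ∧ x ∈ LinearMap.range (inclTensor F) := by
  induction x using algTensor_induction with
  | smul r f =>
    refine ⟨fun j => ℝ ∙ f j, fun j => inferInstance, Submodule.smul_mem _ _
      ⟨algTprod _ (fun j => ⟨f j, Submodule.mem_span_singleton_self _⟩), ?_⟩⟩
    rw [inclTensor_tprod]
  | add x y hx hy =>
    obtain ⟨F, hF, x', rfl⟩ := hx
    obtain ⟨G, hG, y', rfl⟩ := hy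
    exact ⟨fun j => F j ⊔ G j, fun j => inferInstance, Submodule.add_mem _
      (range_inclTensor_mono (fun j => le_sup_left) x')
      (range_inclTensor_mono (fun j => le_sup_right) y')⟩

theorem inducedForm_self_of_finite [∀ j, FiniteDimensional ℝ (V j)] (x : AlgTensor V) :
    0 ≤ inducedForm V x x ∧ (inducedForm V x x = 0 → x = 0) := by
  classical
  let e := fun j => stdOrthonormalBasis ℝ (V j)
  let b : Module.Basis _ ℝ (AlgTensor V) := Basis.piTensorProduct (fun j => (e j).toBasis)
  have hb : ∀ p q, inducedForm V (b p) (b q) = if p = q then 1 else 0 := by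
    intro p q
    have hp : ∀ p, b p = algTprod V (fun j => e j (p j)) := by
      intro p
      refine (Basis.piTensorProduct_apply (fun j => (e j).toBasis) p).trans ?_
      simp only [OrthonormalBasis.coe_toBasis]
      rfl
    rw [hp, hp, inducedForm_tprod]
    simp only [OrthonormalBasis.inner_eq_ite, Fintype.prod_ite_zero, Finset.prod_const_one,
      funext_iff]
  have hx : inducedForm V x x = ∑ p, (b.repr x p) ^ 2 := by
    conv_lhs => rw [← b.sum_repr x]
    simp only [map_sum, map_smul, LinearMap.sum_apply, LinearMap.smul_apply, hb, smul_eq_mul,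
      mul_ite, mul_one, mul_zero, Finset.mem_univ, if_true, sq, Finset.sum_ite_eq']
  rw [hx]
  refine ⟨Finset.sum_nonneg fun _ _ => sq_nonneg _, fun h => ?_⟩
  rw [Finset.sum_eq_zero_iff_of_nonneg fun _ _ => sq_nonneg _] at h
  refine b.ext_elem fun p => ?_
  simpa using h p (Finset.mem_univ p)

variable (V) in
/-- The induced scalar product is a scalar product. -/
@[reducible] def inducedCore : InnerProductSpace.Core ℝ (AlgTensor V) where
  inner x y := inducedForm V x y
  conj_inner_symm x y := by simpa using inducedForm_symm y x
  re_inner_nonneg x := by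
    obtain ⟨F, hF, y, rfl⟩ := exists_finite_incl x
    simpa [inducedForm_incl] using (inducedForm_self_of_finite y).1
  add_left x y z := by simp
  smul_left x y r := by simp
  definite x hx := by
    obtain ⟨F, hF, y, rfl⟩ := exists_finite_incl x
    rw [inducedForm_incl] at hx
    rw [(inducedForm_self_of_finite y).2 hx, map_zero]

instance : NormedAddCommGroup (AlgTensor V) := (inducedCore V).toNormedAddCommGroup

instance : InnerProductSpace ℝ (AlgTensor V) := .ofCore _

variable (V) in
/-- The Hilbert tensor space: completion of the algebraic tensor product with respect to the norm
of the induced scalar product. -/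
abbrev HilbertTensor : Type (max u v) := UniformSpace.Completion (AlgTensor V)

/-- The elementary tensor `⨂ j, x j` as an element of the Hilbert tensor space. -/
def pureTensor (x : ∀ j, V j) : HilbertTensor V := ((algTprod V x : AlgTensor V) : HilbertTensor V)

theorem inner_pureTensor (x y : ∀ j, V j) :
    ⟪pureTensor x, pureTensor y⟫_ℝ = ∏ j, ⟪x j, y j⟫_ℝ :=
  (UniformSpace.Completion.inner_coe _ _).trans (inducedForm_tprod x y)

/-- The Hartree manifold: the nonzero multiples of elementary tensors with nonzero factors, that is,
the tensors of rank `(1, …, 1)`. -/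
def hartreeManifold : Set (HilbertTensor V) :=
  {x | ∃ (c : ℝ) (a : ∀ j, V j), c ≠ 0 ∧ (∀ j, a j ≠ 0) ∧ x = c • pureTensor a}

/-- For `x = c • ⨂ a j` of rank one, the minimal subspaces are `U j = span {a j}`, with complement
`W j = (U j)ᗮ`. This is the inverse of the local chart of the Hartree manifold at `x`, composed with
the inclusion into the Hilbert tensor space: `(L, s) ↦ s • ⨂ j, (id + L j) (a j)`, where the linear
map `L j : U j → W j` is represented by its value `w j = L j (a j)` in `W j`, and `s` is real. The
point `x` has the coordinates `(0, c)`. -/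
def hartreeChart (a : ∀ j, V j) (p : (∀ j, (ℝ ∙ a j : Submodule ℝ (V j))ᗮ) × ℝ) :
    HilbertTensor V :=
  p.2 • pureTensor fun j => a j + (p.1 j : V j)

/-- The tangent space of the Hartree manifold at `x`, as a set of vectors of the Hilbert tensor
space: the image of the tangent map of the inclusion, computed in the chart at `x`. It does not
depend on the representation `x = c • ⨂ a j`. -/
def hartreeTangent (x : HilbertTensor V) : Set (HilbertTensor V) :=
  {z | ∃ (c : ℝ) (a : ∀ j, V j), c ≠ 0 ∧ (∀ j, a j ≠ 0) ∧ x = c • pureTensor a ∧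
    z ∈ Set.range (fderiv ℝ (hartreeChart a) (0, c))}

/-- `p` is the metric projection of `f` onto `K`. -/
def IsMetricProjection {H : Type*} [NormedAddCommGroup H] (K : Set H) (f p : H) : Prop :=
  p ∈ K ∧ ∀ z ∈ K, ‖p - f‖ ≤ ‖z - f‖

/-- `x` solves the Dirac–Frenkel reduced model `x' (t) = P_{x (t)} (A x (t))` on the Hartree
manifold for `t ∈ (0, ε)`, with `x 0 = x₀` on the manifold. The linear operator `A` may be
unbounded, with domain `A.domain`. -/
structure IsDiracFrenkelSolution (A : HilbertTensor V →ₗ.[ℝ] HilbertTensor V) (ε : ℝ)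
    (x₀ : HilbertTensor V) (x : ℝ → HilbertTensor V) : Prop where
  init : x 0 = x₀
  mem_manifold : ∀ t ∈ Set.Ico 0 ε, x t ∈ hartreeManifold
  equation : ∀ t ∈ Set.Ioo 0 ε, ∃ (h : x t ∈ A.domain) (x' : HilbertTensor V),
    HasDerivAt x x' t ∧ IsMetricProjection (hartreeTangent (x t)) (A ⟨x t, h⟩) x'

open Classical in
/-- `A x` for `x` in the domain of `A`, and `0` elsewhere. -/
def evalOp (A : HilbertTensor V →ₗ.[ℝ] HilbertTensor V) (x : HilbertTensor V) : HilbertTensor V :=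
  if h : x ∈ A.domain then A ⟨x, h⟩ else 0

open Classical in
/-- The form `(z, y) ↦ ⟪A (z ⊗ ⨂_{j ≠ k} a j), y ⊗ ⨂_{j ≠ k} a j⟫` on `V k`. -/
def hartreeForm (A : HilbertTensor V →ₗ.[ℝ] HilbertTensor V) (a : ∀ j, V j) (k : ι)
    (z y : V k) : ℝ :=
  ⟪evalOp A (pureTensor (Function.update a k z)), pureTensor (Function.update a k y)⟫_ℝ

end Tensor

/-- The tangent space of the unit sphere at `x`: the vectors orthogonal to `x`. -/
def sphereTangent {E : Type*} [NormedAddCommGroup E] [InnerProductSpace ℝ E] (x : E) :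
    Submodule ℝ E := (ℝ ∙ x)ᗮ

end Hartree

end

open scoped Topology InnerProductSpace

noncomputable section

namespace Hartree

universe u v

/-! ### Elementary tensors: continuity, product rule, inner products, tangent vectors -/

section Tensor

variable {ι : Type u} [Fintype ι] {V : ι → Type v}
  [∀ j, NormedAddCommGroup (V j)] [∀ j, InnerProductSpace ℝ (V j)]

/-! Unit length forces each derivative of `v j` to be orthogonal to `v j`, so the product rule
writes the velocity of the curve in the coordinates of the chart at the current point. Adding a
multiple of `⨂ v j`, or of `y ⊗ ⨂_{j ≠ k} v j` with `y ⟂ v k`, stays in the tangent set, so the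
projection error is orthogonal to both directions (`IsMetricProjection.inner_sub_eq_zero`). All
these tensors are mutually orthogonal for different slots, so the tests decouple: the first gives
`λ' = λ ⟪A ⨂ v j, ⨂ v j⟫`, the second the equation of the factor `v k`
(`inner_eq_of_isMetricProjection`). Since `λ` never vanishes, it can be divided out of the argument
of `A`, and the scalar equation integrates to the exponential (`eq_mul_exp_integral`). -/

theorem norm_pureTensor (x : ∀ j, V j) : ‖pureTensor x‖ = ∏ j, ‖x j‖ := by
  rw [← sq_eq_sq₀ (norm_nonneg _) (Finset.prod_nonneg fun _ _ => norm_nonneg _),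
    ← real_inner_self_eq_norm_sq, inner_pureTensor, ← Finset.prod_pow]
  exact Finset.prod_congr rfl fun _ _ => real_inner_self_eq_norm_sq _

variable (V) in
/-- The elementary tensor in the Hilbert tensor space as a continuous multilinear map. -/
def pureTensorL : ContinuousMultilinearMap ℝ V (HilbertTensor V) :=
  ((UniformSpace.Completion.toComplL (𝕜 := ℝ) (E := AlgTensor V)).toLinearMap.compMultilinearMap
    (algTprod V)).mkContinuous 1 fun x => by
      rw [one_mul]
      exact (norm_pureTensor x).le

@[simp] theorem pureTensorL_apply (x : ∀ j, V j) : pureTensorL V x = pureTensor x := rfl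

open Classical in
/-- The derivative of the local chart of the Hartree manifold. -/
theorem hasFDerivAt_hartreeChart (a : ∀ j, V j) (c : ℝ) :
    ∃ L : ((∀ j, (ℝ ∙ a j : Submodule ℝ (V j))ᗮ) × ℝ) →L[ℝ] HilbertTensor V,
      HasFDerivAt (hartreeChart a) L (0, c) ∧
      ∀ p, L p = c • ∑ j, pureTensor (Function.update a j (p.1 j : V j))
        + p.2 • pureTensor a := by
  let inc : ((∀ j, (ℝ ∙ a j : Submodule ℝ (V j))ᗮ) × ℝ) →L[ℝ] (∀ j, V j) :=
    .pi fun j => (Submodule.subtypeL _).comp ((ContinuousLinearMap.proj j).comp (.fst ℝ _ _))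
  have hinc : HasFDerivAt (fun p => a + inc p) inc (0, c) := inc.hasFDerivAt.const_add a
  have h0 : a + inc (0, c) = a := by ext j; simp [inc]
  have hM := ((pureTensorL V).hasFDerivAt (a + inc (0, c))).comp (0, c) hinc
  rw [h0] at hM
  have hs : HasFDerivAt (fun p : (∀ j, (ℝ ∙ a j : Submodule ℝ (V j))ᗮ) × ℝ => p.2) _ (0, c) :=
    hasFDerivAt_snd (𝕜 := ℝ)
  refine ⟨_, hs.smul hM, fun p => ?_⟩
  simp [inc]

open Classical in
theorem hasDerivAt_pureTensor {v : ∀ j, ℝ → V j} {t : ℝ} {v' : ∀ j, V j}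
    (hv : ∀ j, HasDerivAt (v j) (v' j) t) :
    HasDerivAt (fun s => pureTensor fun j => v j s)
      (∑ j, pureTensor (Function.update (fun i => v i t) j (v' j))) t := by
  have h := ((pureTensorL V).hasFDerivAt (fun j => v j t)).comp_hasDerivAt t (hasDerivAt_pi.2 hv)
  rw [ContinuousMultilinearMap.linearDeriv_apply] at h
  exact h

open Classical in
theorem inner_pureTensor_update {a : ∀ j, V j} (ha : ∀ j, ‖a j‖ = 1) (k : ι) (x y : V k) :
    ⟪pureTensor (Function.update a k x), pureTensor (Function.update a k y)⟫_ℝ = ⟪x, y⟫_ℝ := by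
  rw [inner_pureTensor, Finset.prod_eq_single k]
  · simp
  · intro j _ hj
    simp [Function.update_of_ne hj, ha]
  · simp

open Classical in
-- The left tensor still carries `a k` in slot `k`, and that one factor kills the product.
theorem inner_pureTensor_update_of_ne {a : ∀ j, V j} {j k : ι} (hjk : j ≠ k) (x : V j) {y : V k}
    (hy : ⟪a k, y⟫_ℝ = 0) :
    ⟪pureTensor (Function.update a j x), pureTensor (Function.update a k y)⟫_ℝ = 0 := by
  rw [inner_pureTensor]
  exact Finset.prod_eq_zero (Finset.mem_univ k) (by simp [Function.update_of_ne hjk.symm, hy])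

open Classical in
/-- The tensors `c • ∑ j, w j ⊗ ⨂_{i ≠ j} a i + s • ⨂ j, a j` with `w j ⟂ a j` are tangent to the
Hartree manifold. -/
theorem mem_hartreeTangent {a w : ∀ j, V j} {c : ℝ} (hc : c ≠ 0) (ha : ∀ j, a j ≠ 0)
    (hw : ∀ j, ⟪a j, w j⟫_ℝ = 0) (s : ℝ) :
    c • ∑ j, pureTensor (Function.update a j (w j)) + s • pureTensor a
      ∈ hartreeTangent (c • pureTensor a) := by
  obtain ⟨L, hL, hLp⟩ := hasFDerivAt_hartreeChart a c
  refine ⟨c, a, hc, ha, rfl, (fun j => ⟨w j, Submodule.mem_orthogonal_singleton_iff_inner_right.2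
    (hw j)⟩, s), ?_⟩
  rw [hL.fderiv, hLp]

end Tensor

/-- First variation: `r ↦ ‖p + r • z - f‖²` is a quadratic with minimum at `r = 0`. Only the line
through `p` has to lie in `K`; neither linearity nor closedness of `K` enters. -/
theorem IsMetricProjection.inner_sub_eq_zero {H : Type*} [NormedAddCommGroup H]
    [InnerProductSpace ℝ H] {K : Set H} {f p z : H} (hp : IsMetricProjection K f p)
    (hz : ∀ r : ℝ, p + r • z ∈ K) : ⟪p - f, z⟫_ℝ = 0 := by
  have key : ∀ r : ℝ, 0 ≤ 2 * r * ⟪p - f, z⟫_ℝ + r ^ 2 * ‖z‖ ^ 2 := fun r => by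
    have h := pow_le_pow_left₀ (norm_nonneg _) (hp.2 _ (hz r)) 2
    rw [show p + r • z - f = (p - f) + r • z by abel, norm_add_sq_real, norm_smul, mul_pow,
      inner_smul_right, Real.norm_eq_abs, sq_abs] at h
    linarith
  -- Nearly the minimiser of the quadratic; `1 + ‖z‖ ^ 2` in place of `‖z‖ ^ 2` also covers `z = 0`.
  have h := key (-⟪p - f, z⟫_ℝ / (1 + ‖z‖ ^ 2))
  have hpos : 0 < 1 + ‖z‖ ^ 2 := by positivity
  set b := ⟪p - f, z⟫_ℝ
  set n := ‖z‖ ^ 2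
  have hn : 0 ≤ n := sq_nonneg _
  have e : 2 * (-b / (1 + n)) * b + (-b / (1 + n)) ^ 2 * n
      = -(b ^ 2 * (2 + n)) / (1 + n) ^ 2 := by
    field_simp
    ring
  rw [e, neg_div, Left.nonneg_neg_iff, div_le_iff₀ (by positivity), zero_mul] at h
  nlinarith [sq_nonneg b]

/-- A `C¹` function without zeros that satisfies `f' = f g` is an exponential. -/
theorem eq_mul_exp_integral {f g : ℝ → ℝ} {ε : ℝ} (hf : ContDiffOn ℝ 1 f (Set.Ico 0 ε))
    (hne : ∀ t ∈ Set.Ico 0 ε, f t ≠ 0)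
    (hd : ∀ t ∈ Set.Ioo 0 ε, HasDerivAt f (f t * g t) t) {t : ℝ} (ht : t ∈ Set.Ico 0 ε) :
    IntervalIntegrable g MeasureTheory.volume 0 t ∧
      f t = f 0 * Real.exp (∫ s in (0 : ℝ)..t, g s) := by
  have hε : 0 < ε := ht.1.trans_lt ht.2
  have hsub : Set.Icc 0 t ⊆ Set.Ico 0 ε := fun s hs => ⟨hs.1, hs.2.trans_lt ht.2⟩
  have hc : ContinuousOn f (Set.Icc 0 t) := hf.continuousOn.mono hsub
  -- Nothing is known about `g` at `0`; the quotient `f' / f`, with the one-sided derivative there,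
  -- is a continuous function that agrees with `g` on the open interval.
  have hq : ContinuousOn (fun s => derivWithin f (Set.Ico 0 ε) s / f s) (Set.Icc 0 t) :=
    ((hf.continuousOn_derivWithin (uniqueDiffOn_Ico 0 ε) le_rfl).mono hsub).div hc
      fun s hs => hne s (hsub hs)
  have hqg : ∀ s ∈ Set.Ioo 0 ε, derivWithin f (Set.Ico 0 ε) s / f s = g s := fun s hs => by
    rw [derivWithin_of_mem_nhds (Ico_mem_nhds hs.1 hs.2), (hd s hs).deriv,
      mul_div_cancel_left₀ _ (hne s ⟨hs.1.le, hs.2⟩)]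
  have hg : IntervalIntegrable g MeasureTheory.volume 0 t := by
    refine (hq.intervalIntegrable_of_Icc ht.1).congr ?_
    intro s hs
    rw [Set.uIoc_of_le ht.1] at hs
    exact hqg s ⟨hs.1, hs.2.trans_lt ht.2⟩
  refine ⟨hg, ?_⟩
  have hint : ∫ s in (0 : ℝ)..t, g s = Real.log (f t) - Real.log (f 0) := by
    refine intervalIntegral.integral_eq_sub_of_hasDerivAt_of_le ht.1
      (hc.log fun s hs => hne s (hsub hs)) (fun s hs => ?_) hg
    have hs' : s ∈ Set.Ioo 0 ε := ⟨hs.1, hs.2.trans ht.2⟩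
    have hs0 := hne s ⟨hs.1.le, hs'.2⟩
    simpa [mul_div_cancel_left₀ _ hs0] using (hd s hs').log hs0
  have h0 : f 0 ≠ 0 := hne 0 ⟨le_rfl, hε⟩
  have ht0 : f t ≠ 0 := hne t ht
  -- `Real.log` sees only `|f|`; the intermediate value theorem excludes a change of sign.
  have hsign : 0 < f t / f 0 := by
    by_contra hneg
    have hq0 : ContinuousOn (fun s => f s / f 0) (Set.Icc 0 t) := hc.div_const _
    obtain ⟨s, hs, hs0⟩ := intermediate_value_Icc' ht.1 hq0
      (show (0 : ℝ) ∈ _ from ⟨not_lt.1 hneg, by simp [h0]⟩)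
    exact div_ne_zero (hne s (hsub hs)) h0 hs0
  rw [hint, ← Real.log_div ht0 h0, Real.exp_log hsign, mul_div_cancel₀ _ h0]

section Solution

variable {ι : Type u} [Fintype ι] {V : ι → Type v}
  [∀ j, NormedAddCommGroup (V j)] [∀ j, InnerProductSpace ℝ (V j)]

open Classical in
/-- The equations for the factors of a tensor whose velocity is the metric projection of `c • f`
onto the tangent space of the Hartree manifold. -/
theorem inner_eq_of_isMetricProjection {a w : ∀ j, V j} {c s : ℝ} {f : HilbertTensor V}
    (hc : c ≠ 0) (ha : ∀ j, ‖a j‖ = 1) (hw : ∀ j, ⟪a j, w j⟫_ℝ = 0)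
    (hp : IsMetricProjection (hartreeTangent (c • pureTensor a)) (c • f)
      (c • ∑ j, pureTensor (Function.update a j (w j)) + s • pureTensor a)) :
    s = c * ⟪f, pureTensor a⟫_ℝ ∧
      ∀ k, ∀ y : V k, ⟪a k, y⟫_ℝ = 0 →
        ⟪w k, y⟫_ℝ = ⟪f, pureTensor (Function.update a k y)⟫_ℝ := by
  have ha0 : ∀ j, a j ≠ 0 := fun j h => by simpa [h] using ha j
  have haa : ⟪pureTensor a, pureTensor a⟫_ℝ = 1 := by
    rw [inner_pureTensor]
    simp [ha]
  have hself : ∀ k (y : V k), ⟪a k, y⟫_ℝ = 0 →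
      ⟪pureTensor a, pureTensor (Function.update a k y)⟫_ℝ = 0 := fun k y hy => by
    have h := inner_pureTensor_update ha k (a k) y
    rwa [Function.update_eq_self, hy] at h
  constructor
  · have h := hp.inner_sub_eq_zero (z := pureTensor a) fun r => by
      rw [add_assoc, ← add_smul]
      exact mem_hartreeTangent hc ha0 hw _
    have hz : ∀ j, ⟪pureTensor (Function.update a j (w j)), pureTensor a⟫_ℝ = 0 := fun j => by
      rw [real_inner_comm, hself j _ (hw j)]
    simp only [inner_sub_left, inner_add_left, inner_smul_left, sum_inner, hz, haa,
      Finset.sum_const_zero, RCLike.conj_to_real] at h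
    linarith
  · intro k y hy
    -- The factor `c` lets the shift by `r • z` be absorbed by replacing `w k` with `w k + r • y`.
    have h := hp.inner_sub_eq_zero (z := c • pureTensor (Function.update a k y)) fun r => by
      have e : c • ∑ j, pureTensor (Function.update a j (w j)) + s • pureTensor a
          + r • c • pureTensor (Function.update a k y)
          = c • ∑ j, pureTensor (Function.update a j (w j + (Pi.single k (r • y) : ∀ j, V j) j))
            + s • pureTensor a := by
        have e1 : ∀ j, pureTensor (Function.update a j
            (w j + (Pi.single k (r • y) : ∀ j, V j) j))
            = pureTensor (Function.update a j (w j))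
              + pureTensor (Function.update a j ((Pi.single k (r • y) : ∀ j, V j) j)) :=
          fun j => (pureTensorL V).map_update_add a j _ _
        have e2 : ∑ j, pureTensor (Function.update a j ((Pi.single k (r • y) : ∀ j, V j) j))
            = r • pureTensor (Function.update a k y) := by
          rw [Finset.sum_eq_single k]
          · rw [Pi.single_eq_same]
            exact (pureTensorL V).map_update_smul a k r y
          · intro j _ hj
            rw [Pi.single_eq_of_ne hj]
            exact (pureTensorL V).map_update_zero a j
          · simp
        rw [Finset.sum_congr rfl fun j _ => e1 j, Finset.sum_add_distrib, e2, smul_add,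
          smul_comm r c]
        abel
      rw [e]
      refine mem_hartreeTangent hc ha0 (fun j => ?_) _
      rcases eq_or_ne j k with rfl | hj
      · simp [inner_add_right, inner_smul_right, hw, hy]
      · simp [Pi.single_eq_of_ne hj, hw]
    have hsum : ∑ j, ⟪pureTensor (Function.update a j (w j)),
        pureTensor (Function.update a k y)⟫_ℝ = ⟪w k, y⟫_ℝ := by
      rw [Finset.sum_eq_single k, inner_pureTensor_update ha]
      · exact fun j _ hj => inner_pureTensor_update_of_ne hj _ hy
      · simp
    simp only [inner_sub_left, inner_add_left, inner_smul_left, inner_smul_right, sum_inner, hsum,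
      hself k y hy, RCLike.conj_to_real] at h
    have h' : c * c * (⟪w k, y⟫_ℝ - ⟪f, pureTensor (Function.update a k y)⟫_ℝ) = 0 := by
      linear_combination h
    simpa [hc, sub_eq_zero] using h'

theorem evalOp_of_mem (A : HilbertTensor V →ₗ.[ℝ] HilbertTensor V) {x : HilbertTensor V}
    (h : x ∈ A.domain) : evalOp A x = A ⟨x, h⟩ := dif_pos h

/-- The derivative of a curve of unit vectors is orthogonal to the curve. -/
theorem inner_deriv_eq_zero_of_norm_eq_one {E : Type*} [NormedAddCommGroup E]
    [InnerProductSpace ℝ E] {u : ℝ → E} {u' : E} {t : ℝ} (hu : HasDerivAt u u' t)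
    (h1 : ∀ᶠ s in 𝓝 t, ‖u s‖ = 1) : ⟪u t, u'⟫_ℝ = 0 := by
  have h := (hu.norm_sq).unique
    ((hasDerivAt_const t (1 : ℝ)).congr_of_eventuallyEq (h1.mono fun s hs => by simp [hs]))
  linarith

end Solution

end Hartree

end

/-! ### The time dependent Hartree equations -/

open Hartree in
theorem mainTheorem11 {ι : Type*} [Fintype ι] {V : ι → Type*}
    [∀ j, NormedAddCommGroup (V j)] [∀ j, InnerProductSpace ℝ (V j)]
    (A : HilbertTensor V →ₗ.[ℝ] HilbertTensor V) (ε : ℝ) (hε : 0 < ε)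
    (lam₀ : ℝ) (v₀ : ∀ j, V j) (hv₀ : ∀ j, ‖v₀ j‖ = 1)
    (lam : ℝ → ℝ) (v : ∀ j, ℝ → V j)
    (hlam : ContDiffOn ℝ 1 lam (Set.Ico 0 ε))
    (hv : ∀ j, ContDiffOn ℝ 1 (v j) (Set.Ico 0 ε))
    (hunit : ∀ t ∈ Set.Ico 0 ε, ∀ j, ‖v j t‖ = 1)
    (hlam₀ : lam 0 = lam₀)
    (hsol : IsDiracFrenkelSolution A ε (lam₀ • pureTensor v₀)
      (fun t => lam t • pureTensor (fun j => v j t))) :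
    (∀ t ∈ Set.Ioo 0 ε, pureTensor (fun j => v j t) ∈ A.domain ∧
      ∀ j, ∀ w ∈ sphereTangent (v j t),
        inner ℝ (deriv (v j) t) w - hartreeForm A (fun i => v i t) j (v j t) w = 0) ∧
    ∀ t ∈ Set.Ico 0 ε,
      IntervalIntegrable (fun s => inner ℝ (evalOp A (pureTensor (fun j => v j s)))
        (pureTensor (fun j => v j s))) MeasureTheory.volume 0 t ∧
      lam t = lam₀ * Real.exp (∫ s in (0 : ℝ)..t,
        inner ℝ (evalOp A (pureTensor (fun j => v j s))) (pureTensor (fun j => v j s))) := by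
  have hne : ∀ t ∈ Set.Ico 0 ε, lam t ≠ 0 := fun t ht h0 => by
    obtain ⟨c, a, hc, ha, h⟩ := hsol.mem_manifold t ht
    have hn := congrArg norm h
    simp only [h0, zero_smul, norm_zero, norm_smul, norm_pureTensor] at hn
    exact mul_ne_zero (norm_ne_zero_iff.2 hc)
      (Finset.prod_ne_zero_iff.2 fun j _ => norm_ne_zero_iff.2 (ha j)) hn.symm
  have key : ∀ t ∈ Set.Ioo 0 ε, pureTensor (fun j => v j t) ∈ A.domain ∧
      HasDerivAt lam (lam t * inner ℝ (evalOp A (pureTensor fun j => v j t))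
        (pureTensor fun j => v j t)) t ∧
      ∀ j, ∀ w ∈ sphereTangent (v j t),
        inner ℝ (deriv (v j) t) w - hartreeForm A (fun i => v i t) j (v j t) w = 0 := by
    classical
    intro t ht
    have ht' : t ∈ Set.Ico 0 ε := ⟨ht.1.le, ht.2⟩
    have hnhds := Ico_mem_nhds ht.1 ht.2
    have hl : HasDerivAt lam (deriv lam t) t :=
      ((hlam.contDiffAt hnhds).differentiableAt one_ne_zero).hasDerivAt
    have hvd : ∀ j, HasDerivAt (v j) (deriv (v j) t) t := fun j =>
      (((hv j).contDiffAt hnhds).differentiableAt one_ne_zero).hasDerivAt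
    have horth : ∀ j, inner ℝ (v j t) (deriv (v j) t) = 0 := fun j =>
      inner_deriv_eq_zero_of_norm_eq_one (hvd j)
        (Filter.mem_of_superset hnhds fun s hs => hunit s hs j)
    obtain ⟨hmem, x', hx', hproj⟩ := hsol.equation t ht
    have hdom : pureTensor (fun j => v j t) ∈ A.domain :=
      (A.domain.smul_mem_iff (hne t ht')).1 hmem
    have hA : A ⟨lam t • pureTensor (fun j => v j t), hmem⟩
        = lam t • evalOp A (pureTensor fun j => v j t) := by
      rw [evalOp_of_mem A hdom, ← A.map_smul]
      rfl
    -- Uniqueness of the derivative identifies the projection with the velocity given by the product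
    -- rule.
    rw [hA, hx'.unique (hl.smul (hasDerivAt_pureTensor hvd))] at hproj
    obtain ⟨h1, h2⟩ := inner_eq_of_isMetricProjection (hne t ht') (hunit t ht') horth hproj
    refine ⟨hdom, h1 ▸ hl, fun j w hw => ?_⟩
    rw [h2 j w (Submodule.mem_orthogonal_singleton_iff_inner_right.1 hw), hartreeForm,
      Function.update_eq_self, sub_eq_zero]
  refine ⟨fun t ht => ⟨(key t ht).1, (key t ht).2.2⟩, fun t ht => ?_⟩
  rw [← hlam₀]
  exact eq_mul_exp_integral hlam hne (fun s hs => (key s hs).2.1) ht
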